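/- Let $K$ be a field, let $q\in K$ be nonzero and not a root of unity (for instance a formal variable), and fix a square root $q^{1/2}\in K$ of $q$. For an integer $n\ge 0$ put $(q;q)_n=\prod_{k=1}^{n}(1-q^k)$, and put $1/(q;q)_n=0$ for $n<0$. For integers $N,m$ put $$\begin{bmatrix}N\\ m\end{bmatrix}_q=\frac{(q;q)_N}{(q;q)_m(q;q)_{N-m}}\ \text{ if } 0\le m\le N,\qquad \begin{bmatrix}N\\ m\end{bmatrix}_q=0\ \text{ otherwise.}$$ For an integer $L\ge 0$ and integers $a,b,n$ put $$\begin{pmatrix}L,\,b\\ a\end{pmatrix}_{2;\,q}=\sum_{k\ge 0}q^{k(k+b)}\frac{(q;q)_L}{(q;q)_k(q;q)_{k+a}(q;q)_{L-2k-a}},\qquad T_n(L,a)=q^{(L(L-n)-a(a-n))/2}\begin{pmatrix}L,\,a-n\\ a\end{pmatrix}_{2;\,1/q}.$$ Let $F_i(L)$ ($L\in\mathbb Z_{\ge 0}$) and $\alpha_i(a)$ ($a\in\mathbb Z$), $i\in\{-1,0,1\}$, be sequences in $K$. All sums below have only finitely many nonzero terms. **Theorem.** (i) If $F_0(L)=\sum_{a=-\infty}^{\infty}\alpha_0(a)\,T_0(L,a)$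 for all $L\ge 0$, then for all $L\ge 0$ $$\sum_{i\ge 0}q^{i^2/2}\begin{bmatrix}L\\ i\end{bmatrix}_qF_0(i)=\sum_{a=-\infty}^{\infty}\alpha_0(a)\,q^{a^2/2}\begin{bmatrix}2L\\ L-a\end{bmatrix}_q.$$ (ii) If $F_1(L)=\sum_{a=-\infty}^{\infty}\alpha_1(a)\,T_1(L,a)$ for all $L\ge 0$, then for all $L\ge 0$ $$(1+q^L)\sum_{i\ge 0}q^{\binom i2}\begin{bmatrix}L\\ i\end{bmatrix}_qF_1(i)=\sum_{a=-\infty}^{\infty}\alpha_1(a)\,(1+q^a)\,q^{\binom a2}\begin{bmatrix}2L\\ L-a\end{bmatrix}_q.$$ (iii) If $F_{-1}(L)=\sum_{a=-\infty}^{\infty}\alpha_{-1}(a)\,\bigl\{T_{-1}(L,a)+T_{-1}(L,a+1)\bigr\}$ for all $L\ge 0$, then for all $L\ge 0$ $$\sum_{i\ge 0}q^{\binom{i+1}2}\begin{bmatrix}L\\ i\end{bmatrix}_qF_{-1}(i)=\sum_{a=-\infty}^{\infty}\alpha_{-1}(a)\,q^{\binom{a+1}2}\begin{bmatrix}2L+1\\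 L-a\end{bmatrix}_q.$$ Here $\binom x2=x(x-1)/2$ for every integer $x$. -/

import Mathlib

namespace QTrinomial

variable {K : Type*} [Field K]

/-- The `q`-Pochhammer symbol `(a; q)_n = (1 - a)(1 - a q) ⋯ (1 - a q ^ (n - 1))`. -/
def qPoch (a q : K) (n : ℕ) : K := ∏ k ∈ Finset.range n, (1 - a * q ^ k)

/-- The reciprocal `1 / (q; q)_n` for an integer `n`, which is `0` for `n < 0`. -/
def recipQPoch (q : K) (n : ℤ) : K := if 0 ≤ n then (qPoch q q n.toNat)⁻¹ else 0

/-- The `q`-binomial coefficient `[N, m]_q = (q; q)_N / ((q; q)_m (q; q)_{N - m})` for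
`0 ≤ m ≤ N`, and `0` otherwise. -/
def qBinom (q : K) (N m : ℤ) : K :=
  if 0 ≤ m ∧ m ≤ N then
    qPoch q q N.toNat / (qPoch q q m.toNat * qPoch q q (N - m).toNat)
  else 0

/-- The Andrews–Baxter `q`-trinomial coefficient `(L, b; a; q)_2`, the sum over `n ≥ 0` of
`q ^ (n (n + b)) (q; q)_L / ((q; q)_n (q; q)_{n + a} (q; q)_{L - 2 n - a})`.
Only finitely many terms are nonzero, see `support_roundTrinomial`. -/
noncomputable def roundTrinomial (q : K) (L : ℕ) (b a : ℤ) : K :=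
  ∑ᶠ n : ℕ, q ^ ((n : ℤ) * (n + b)) *
    (qPoch q q L * recipQPoch q n * recipQPoch q (n + a) * recipQPoch q (L - 2 * n - a))

/-- The `q`-trinomial coefficient `T_n(L; a; q)`, that is
`q ^ ((L (L - n) - a (a - n)) / 2) (L, a - n; a; 1 / q)_2`. Since half-integral powers of `q`
occur, the argument is a square root `r` of `q`, so that `q = r ^ 2`. -/
noncomputable def T (r : K) (n : ℤ) (L : ℕ) (a : ℤ) : K :=
  r ^ ((L : ℤ) * (L - n) - a * (a - n)) * roundTrinomial (1 / r ^ 2) L (a - n) a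

theorem recipQPoch_of_neg (q : K) {n : ℤ} (hn : n < 0) : recipQPoch q n = 0 := by
  simp [recipQPoch, not_le.mpr hn]

theorem support_roundTrinomial (q : K) (L : ℕ) (b a : ℤ) :
    (Function.support fun n : ℕ => q ^ ((n : ℤ) * (n + b)) *
      (qPoch q q L * recipQPoch q n * recipQPoch q (n + a) *
        recipQPoch q (L - 2 * n - a))) ⊆ (Finset.range (L + 1) : Finset ℕ) := by
  intro n hn
  by_contra h
  apply hn
  have h' : L < n := by simpa [Nat.lt_succ_iff] using h
  rcases lt_or_ge ((n : ℤ) + a) 0 with h1 | h1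
  · simp [recipQPoch_of_neg q h1]
  · have h2 : (L : ℤ) - 2 * n - a < 0 := by omega
    simp [recipQPoch_of_neg q h2]

theorem roundTrinomial_eq_zero (q : K) (L : ℕ) (b a : ℤ) (ha : a < -L ∨ L < a) :
    roundTrinomial q L b a = 0 := by
  unfold roundTrinomial
  apply finsum_eq_zero_of_forall_eq_zero
  intro n
  rcases lt_or_ge ((n : ℤ) + a) 0 with h1 | h1
  · simp [recipQPoch_of_neg q h1]
  · have h2 : (L : ℤ) - 2 * n - a < 0 := by omega
    simp [recipQPoch_of_neg q h2]

/-- `T_n(L; a; q)` vanishes for `|a| > L`, so sums over all `a` of multiples of it are finite. -/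
theorem T_eq_zero (r : K) (n : ℤ) (L : ℕ) (a : ℤ) (ha : a < -L ∨ L < a) : T r n L a = 0 := by
  simp [T, roundTrinomial_eq_zero _ L _ a ha]

/-- `[N, m]_q` vanishes outside `0 ≤ m ≤ N`, so sums of multiples of it over `m` are finite. -/
theorem qBinom_eq_zero (q : K) (N m : ℤ) (hm : m < 0 ∨ N < m) : qBinom q N m = 0 := by
  have : ¬ (0 ≤ m ∧ m ≤ N) := by omega
  simp [qBinom, this]

end QTrinomial

/-! All sums are finite and linear in `α`, so each identity is checked on a single kernel `T_n(i,
a)`. Written in base `q`, the `k`-th term of `T_n(i, a)` carries `q^{(i-2k-a)(i-2k-a-n)/2}`.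
Multiply by `q^{i(i-n)/2} [L, i]` and substitute `i = u + k + a`: the exponent separates into an
`a`-part, a `u`-part and a `k`-part. The `k`-sum is then a `q`-Vandermonde sum equal to `[L, u+a]`,
which leaves `q^{a(a-n)/2} ∑_u q^{u(u+a-n)} [L, u] [L, u+a]` (`sum_qBinom_mul_T`). For `n = 0` this
is again `q`-Vandermonde. For `n = 1` the factor `1 + q^L` makes it summable
(`one_add_pow_mul_sum_qBinom`); for `n = -1` adding the sums for `a` and `a + 1` does
(`sum_qBinom_mul_qBinom_succ`). -/

namespace QTrinomial

/-! ### Pascal rules and the `q`-Vandermonde convolution -/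

section Basic

variable {K : Type*} [Field K] {q r : K}

theorem qPoch_succ_self (q : K) (n : ℕ) :
    qPoch q q (n + 1) = qPoch q q n * (1 - q ^ (n + 1)) := by
  rw [qPoch, Finset.prod_range_succ, ← qPoch, pow_succ']

theorem qPoch_self_ne_zero (hq : ∀ n : ℕ, 1 ≤ n → q ^ n ≠ 1) (n : ℕ) : qPoch q q n ≠ 0 := by
  refine Finset.prod_ne_zero_iff.2 fun k _ => ?_
  rw [← pow_succ', sub_ne_zero]
  exact (hq (k + 1) (by omega)).symm

theorem recipQPoch_natCast (q : K) (n : ℕ) : recipQPoch q n = (qPoch q q n)⁻¹ := by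
  simp [recipQPoch]

theorem qPoch_mul_recipQPoch (hq : ∀ n : ℕ, 1 ≤ n → q ^ n ≠ 1) (n : ℕ) :
    qPoch q q n * recipQPoch q n = 1 := by
  rw [recipQPoch_natCast, mul_inv_cancel₀ (qPoch_self_ne_zero hq n)]

/-- `1 / (q; q)_{n - 1} = (1 - q ^ n) / (q; q)_n`, for every integer `n`. -/
theorem recipQPoch_sub_one (hq : ∀ n : ℕ, 1 ≤ n → q ^ n ≠ 1) (n : ℤ) :
    recipQPoch q (n - 1) = (1 - q ^ n) * recipQPoch q n := by
  rcases lt_trichotomy n 0 with h | rfl | h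
  · simp [recipQPoch_of_neg q h, recipQPoch_of_neg q (show n - 1 < 0 by omega)]
  · simp [recipQPoch_of_neg]
  · obtain ⟨k, rfl⟩ : ∃ k : ℕ, n = (k + 1 : ℕ) := ⟨(n - 1).toNat, by omega⟩
    have h1 : 1 - q ^ (k + 1) ≠ 0 := sub_ne_zero.2 (hq (k + 1) (by omega)).symm
    have h2 : ((k + 1 : ℕ) : ℤ) - 1 = k := by omega
    rw [h2, recipQPoch_natCast, recipQPoch_natCast, qPoch_succ_self, zpow_natCast]
    field_simp

theorem qBinom_natCast (q : K) (N : ℕ) (m : ℤ) :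
    qBinom q N m = qPoch q q N * (recipQPoch q m * recipQPoch q (N - m)) := by
  unfold qBinom
  split_ifs with h
  · rw [recipQPoch, recipQPoch, if_pos h.1, if_pos (by omega), ← mul_inv, div_eq_mul_inv]
    simp
  · rcases not_and_or.1 h with h | h
    · simp [recipQPoch_of_neg q (not_le.1 h)]
    · simp [recipQPoch_of_neg q (show (N : ℤ) - m < 0 by omega)]

theorem qBinom_symm (q : K) (N : ℕ) (m : ℤ) : qBinom q N (N - m) = qBinom q N m := by
  rw [qBinom_natCast, qBinom_natCast, sub_sub_cancel, mul_comm (recipQPoch q m)]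

theorem one_sub_zpow_mul_qBinom (hq : ∀ n : ℕ, 1 ≤ n → q ^ n ≠ 1) (N : ℕ) (m : ℤ) :
    (1 - q ^ m) * qBinom q ((N + 1 : ℕ) : ℤ) m = (1 - q ^ (N + 1)) * qBinom q N (m - 1) := by
  rw [qBinom_natCast, qBinom_natCast, recipQPoch_sub_one hq, qPoch_succ_self,
    show ((N + 1 : ℕ) : ℤ) - m = N - (m - 1) by push_cast; ring]
  ring

theorem one_sub_zpow_mul_qBinom' (hq : ∀ n : ℕ, 1 ≤ n → q ^ n ≠ 1) (N : ℕ) (m : ℤ) :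
    (1 - q ^ (N + 1 - m)) * qBinom q ((N + 1 : ℕ) : ℤ) m = (1 - q ^ (N + 1)) * qBinom q N m := by
  rw [← qBinom_symm q (N + 1), ← qBinom_symm q N m,
    show (N : ℤ) - m = ((N + 1 : ℕ) : ℤ) - m - 1 by push_cast; ring,
    ← one_sub_zpow_mul_qBinom hq]
  push_cast
  rfl

/-- The `q`-Pascal rule. -/
theorem qBinom_succ (hq0 : q ≠ 0) (hq : ∀ n : ℕ, 1 ≤ n → q ^ n ≠ 1) (N : ℕ) (m : ℤ) :
    qBinom q ((N + 1 : ℕ) : ℤ) m =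
      qBinom q N m + q ^ ((N : ℤ) + 1 - m) * qBinom q N (m - 1) := by
  have h : (1 - q ^ (N + 1) : K) ≠ 0 := sub_ne_zero.2 (hq (N + 1) (by omega)).symm
  have h3 : q ^ ((N : ℤ) + 1 - m) * q ^ m = q ^ (N + 1) := by
    rw [← zpow_add₀ hq0, ← zpow_natCast]
    congr 1
    push_cast
    ring
  -- Splits `1 - q^{N+1} = (1 - q^{N+1-m}) + q^{N+1-m} (1 - q^m)` and absorbs each factor.
  apply mul_left_cancel₀ h
  linear_combination one_sub_zpow_mul_qBinom' hq N m +
    q ^ ((N : ℤ) + 1 - m) * one_sub_zpow_mul_qBinom hq N m +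
    qBinom q ((N + 1 : ℕ) : ℤ) m * h3

/-- The other `q`-Pascal rule. -/
theorem qBinom_succ' (hq0 : q ≠ 0) (hq : ∀ n : ℕ, 1 ≤ n → q ^ n ≠ 1) (N : ℕ) (m : ℤ) :
    qBinom q ((N + 1 : ℕ) : ℤ) m = qBinom q N (m - 1) + q ^ m * qBinom q N m := by
  rw [← qBinom_symm, qBinom_succ hq0 hq, ← qBinom_symm q N m, ← qBinom_symm q N (m - 1)]
  push_cast
  congr 2 <;> ring_nf

/-- The `q`-Vandermonde convolution. -/
theorem sum_qBinom_mul_qBinom (hq0 : q ≠ 0) (hq : ∀ n : ℕ, 1 ≤ n → q ^ n ≠ 1) (M N : ℕ)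
    (c : ℤ) :
    ∑ u ∈ Finset.range (M + 1), q ^ ((u : ℤ) * (u + c)) * qBinom q M u * qBinom q N (u + c) =
      qBinom q ((M + N : ℕ) : ℤ) (N - c) := by
  -- Pascal splits `[M+1, u]`. Shifting `u` in the second half gives the sum for `c + 1`, so `c`
  -- must vary; Pascal on `[M+N+1, N-c]` recombines the halves.
  induction M generalizing c with
  | zero =>
    rw [show 0 + N = N from Nat.zero_add N, qBinom_symm]
    simp [show qBinom q 0 0 = 1 by simp [qBinom, qPoch]]
  | succ M ih =>
    have h1 : ∀ u : ℕ, q ^ ((u : ℤ) * (u + c)) * qBinom q ((M + 1 : ℕ) : ℤ) u *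
        qBinom q N (u + c) =
        q ^ ((u : ℤ) * (u + c)) * qBinom q M u * qBinom q N (u + c) +
        q ^ ((u : ℤ) * (u + c) + (M + 1 - u)) * qBinom q M (u - 1) * qBinom q N (u + c) := by
      intro u
      rw [qBinom_succ hq0 hq, zpow_add₀ hq0]
      ring
    have h2 : ∀ u : ℕ, q ^ (((u + 1 : ℕ) : ℤ) * ((u + 1 : ℕ) + c) + (M + 1 - (u + 1 : ℕ))) *
        qBinom q M ((u + 1 : ℕ) - 1) * qBinom q N ((u + 1 : ℕ) + c) =
        q ^ ((M : ℤ) + 1 + c) *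
          (q ^ ((u : ℤ) * (u + (c + 1))) * qBinom q M u * qBinom q N (u + (c + 1))) := by
      intro u
      rw [← mul_assoc, ← mul_assoc, ← zpow_add₀ hq0]
      push_cast
      ring_nf
    simp_rw [h1]
    rw [Finset.sum_add_distrib, Finset.sum_range_succ, ih, Finset.sum_range_succ']
    simp_rw [h2]
    rw [← Finset.mul_sum, ih (c + 1), show M + 1 + N = M + N + 1 by ring, qBinom_succ hq0 hq,
      qBinom_eq_zero q M ((M + 1 : ℕ) : ℤ) (by right; push_cast; omega),
      qBinom_eq_zero q M (((0 : ℕ) : ℤ) - 1) (by left; simp)]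
    push_cast
    ring_nf

/-! ### Passing from base `1/q` to base `q` -/

/-- Each factor satisfies `1 - q^{-k} = -q^{-k} (1 - q^k)`. -/
theorem qPoch_inv (hr : r ^ 2 = q) (hq0 : q ≠ 0) (n : ℕ) :
    qPoch (1 / r ^ 2) (1 / r ^ 2) n = (-1) ^ n * r ^ (-((n : ℤ) * (n + 1))) * qPoch q q n := by
  have hr0 : r ≠ 0 := by rintro rfl; simp at hr; exact hq0 hr.symm
  induction n with
  | zero => simp [qPoch]
  | succ n ih =>
    rw [qPoch_succ_self, qPoch_succ_self, ih]
    have h : r ^ (-(((n + 1 : ℕ) : ℤ) * ((n + 1 : ℕ) + 1))) =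
        r ^ (-((n : ℤ) * (n + 1))) * (q ^ (n + 1))⁻¹ := by
      rw [← hr, ← pow_mul, ← zpow_natCast, ← zpow_neg, ← zpow_add₀ hr0]
      congr 1
      push_cast
      ring
    rw [h, hr, one_div, inv_pow]
    field_simp
    ring

theorem recipQPoch_inv (hr : r ^ 2 = q) (hq0 : q ≠ 0) (n : ℤ) :
    recipQPoch (1 / r ^ 2) n = (-1) ^ n * r ^ (n * (n + 1)) * recipQPoch q n := by
  rcases lt_or_ge n 0 with h | h
  · simp [recipQPoch_of_neg _ h]
  · lift n to ℕ using h
    rw [recipQPoch_natCast, recipQPoch_natCast, qPoch_inv hr hq0, mul_inv, mul_inv, ← zpow_neg,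
      neg_neg, zpow_natCast, ← inv_pow, inv_neg_one]

/-- The `q`-trinomial coefficient `T_n(L; a; q)` as a sum without `1 / q`. -/
theorem T_eq_sum (hr : r ^ 2 = q) (hq0 : q ≠ 0) (n : ℤ) (L B : ℕ) (hB : L ≤ B) (a : ℤ) :
    T r n L a = ∑ k ∈ Finset.range (B + 1),
      r ^ (((L : ℤ) - 2 * k - a) * (L - 2 * k - a - n)) *
        (qPoch q q L * recipQPoch q k * recipQPoch q (k + a) * recipQPoch q (L - 2 * k - a)) := by
  have hr0 : r ≠ 0 := by rintro rfl; simp at hr; exact hq0 hr.symm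
  rw [T, roundTrinomial, finsum_eq_sum_of_support_subset (s := Finset.range (B + 1)) _
    ((support_roundTrinomial _ L (a - n) a).trans
      (Finset.coe_subset.2 (Finset.range_subset_range.2 (by omega)))), Finset.mul_sum]
  refine Finset.sum_congr rfl fun k _ => ?_
  rw [qPoch_inv hr hq0, recipQPoch_inv hr hq0, recipQPoch_inv hr hq0, recipQPoch_inv hr hq0]
  have h1 : (1 / r ^ 2) ^ ((k : ℤ) * (k + (a - n))) = r ^ (-2 * ((k : ℤ) * (k + (a - n)))) := by
    rw [one_div, inv_zpow, ← zpow_natCast, ← zpow_mul, ← zpow_neg]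
    congr 1
    push_cast
    ring
  have h2 : (-1 : K) ^ L * (-1) ^ (k : ℤ) * (-1) ^ ((k : ℤ) + a) *
      (-1) ^ ((L : ℤ) - 2 * k - a) = 1 := by
    have h0 : (-1 : K) ≠ 0 := neg_ne_zero.2 one_ne_zero
    rw [← zpow_natCast, ← zpow_add₀ h0, ← zpow_add₀ h0, ← zpow_add₀ h0,
      show (L : ℤ) + k + (k + a) + (L - 2 * k - a) = 2 * L by ring, zpow_mul]
    simp
  have h3 : r ^ (((L : ℤ) - 2 * k - a) * (L - 2 * k - a - n)) =
      r ^ ((L : ℤ) * (L - n) - a * (a - n)) * r ^ (-2 * ((k : ℤ) * (k + (a - n)))) *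
      r ^ (-((L : ℤ) * (L + 1))) * r ^ ((k : ℤ) * (k + 1)) *
      r ^ (((k : ℤ) + a) * (k + a + 1)) *
      r ^ (((L : ℤ) - 2 * k - a) * (L - 2 * k - a + 1)) := by
    simp only [← zpow_add₀ hr0]
    congr 1
    ring
  rw [h1, h3]
  linear_combination r ^ ((L : ℤ) * (L - n) - a * (a - n)) *
    r ^ (-2 * ((k : ℤ) * (k + (a - n)))) *
      r ^ (-((L : ℤ) * (L + 1))) * r ^ ((k : ℤ) * (k + 1)) *
      r ^ (((k : ℤ) + a) * (k + a + 1)) *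
      r ^ (((L : ℤ) - 2 * k - a) * (L - 2 * k - a + 1)) *
      (qPoch q q L * recipQPoch q k * recipQPoch q (k + a) * recipQPoch q (L - 2 * k - a)) * h2

/-! ### The `q`-binomial transform of `T_n` -/

/-- A sum over `0 ≤ i < n` may be shifted by `c` if both windows contain the support. -/
theorem sum_range_eq_sum_range_add {M : Type*} [AddCommMonoid M] (f : ℤ → M) (n : ℕ) (c : ℤ)
    (h1 : ∀ i, f i ≠ 0 → 0 ≤ i ∧ i < n) (h2 : ∀ i, f (i + c) ≠ 0 → 0 ≤ i ∧ i < n) :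
    ∑ i ∈ Finset.range n, f i = ∑ i ∈ Finset.range n, f (i + c) := by
  have key : ∀ g : ℤ → M, (∀ i, g i ≠ 0 → 0 ≤ i ∧ i < n) →
      ∑ i ∈ Finset.range n, g i = ∑ᶠ i, g i := by
    intro g hg
    rw [finsum_eq_sum_of_support_subset (s := (Finset.range n).map Nat.castEmbedding) g]
    · simp
    · intro i hi
      obtain ⟨h, h'⟩ := hg i hi
      lift i to ℕ using h
      simpa using h'
  rw [key f h1, key (fun i => f (i + c)) h2]
  exact (finsum_comp_equiv (Equiv.addRight c)).symm

/-- The common core of all three parts: `(q;q)_i` cancels between `[L, i]` and `T_n(i, a)`, and `i =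
u + k + a` decouples the exponent, for every integer `n`. -/
theorem sum_qBinom_mul_T (hr : r ^ 2 = q) (hq0 : q ≠ 0) (hq : ∀ n : ℕ, 1 ≤ n → q ^ n ≠ 1)
    (n : ℤ) (L : ℕ) (a : ℤ) :
    ∑ i ∈ Finset.range (L + 1), r ^ ((i : ℤ) * (i - n)) * qBinom q L i * T r n i a =
      r ^ (a * (a - n)) * ∑ u ∈ Finset.range (L + 1),
        q ^ ((u : ℤ) * (u + a - n)) * qBinom q L u * qBinom q L (u + a) := by
  have hr0 : r ≠ 0 := by rintro rfl; simp at hr; exact hq0 hr.symm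
  -- The index `i` is an integer so that it can be shifted by `k + a`, which may be negative; the
  -- reciprocals cut off the support.
  let g : ℕ → ℤ → K := fun k i => r ^ (i * (i - n) + (i - 2 * k - a) * (i - 2 * k - a - n)) *
    (qPoch q q L * recipQPoch q (L - i) * recipQPoch q k * recipQPoch q (k + a) *
      recipQPoch q (i - 2 * k - a))
  have hg : ∀ k i, g k i ≠ 0 → i ≤ L ∧ 0 ≤ k + a ∧ 0 ≤ i - 2 * k - a := by
    intro k i h
    refine ⟨?_, ?_, ?_⟩ <;> by_contra hlt <;> apply h <;> simp only [g]
    · simp [recipQPoch_of_neg q (show (L : ℤ) - i < 0 by omega)]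
    · simp [recipQPoch_of_neg q (show (k : ℤ) + a < 0 by omega)]
    · simp [recipQPoch_of_neg q (show i - 2 * k - a < 0 by omega)]
  have h1 : ∀ i ∈ Finset.range (L + 1), r ^ ((i : ℤ) * (i - n)) * qBinom q L i * T r n i a =
      ∑ k ∈ Finset.range (L + 1), g k i := by
    intro i hi
    -- One range `k ≤ L` serves every `i ≤ L`, so the two sums can be interchanged.
    rw [T_eq_sum hr hq0 n i L (by simpa [Nat.lt_succ_iff] using hi), Finset.mul_sum]
    refine Finset.sum_congr rfl fun k _ => ?_
    simp only [g]
    rw [qBinom_natCast, zpow_add₀ hr0]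
    linear_combination r ^ ((i : ℤ) * (i - n)) *
      r ^ (((i : ℤ) - 2 * k - a) * (i - 2 * k - a - n)) *
      (qPoch q q L * recipQPoch q (L - i) * recipQPoch q k * recipQPoch q (k + a) *
        recipQPoch q (i - 2 * k - a)) * qPoch_mul_recipQPoch hq i
  rw [Finset.sum_congr rfl h1, Finset.sum_comm]
  have h2 : ∀ k ∈ Finset.range (L + 1), ∑ i ∈ Finset.range (L + 1), g k i =
      ∑ u ∈ Finset.range (L + 1), g k (u + (k + a)) := by
    intro k _
    refine sum_range_eq_sum_range_add (g k) (L + 1) (k + a) (fun i hi => ?_) fun i hi => ?_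
    · have := hg k i hi
      push_cast
      omega
    · have := hg k _ hi
      push_cast
      omega
  rw [Finset.sum_congr rfl h2, Finset.sum_comm, Finset.mul_sum]
  refine Finset.sum_congr rfl fun u hu => ?_
  have huL : u ≤ L := by simpa [Nat.lt_succ_iff] using hu
  -- Here `[L, u+a]` is expanded by splitting `L = u + (L - u)`. The range is then enlarged from `k
  -- ≤ u` to `k ≤ L`, since `[u, k] = 0` for `k > u`.
  have h3 := sum_qBinom_mul_qBinom hq0 hq u (L - u) a
  rw [Finset.sum_subset (Finset.range_subset_range.2 (show u + 1 ≤ L + 1 by omega))] at h3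
  swap
  · intro k _ hk
    have hk' : u < k := by simpa [Nat.lt_succ_iff] using hk
    simp [qBinom_eq_zero q u k (by omega)]
  rw [Nat.add_sub_cancel' huL, Nat.cast_sub huL, sub_sub, qBinom_symm] at h3
  rw [← h3, Finset.mul_sum, Finset.mul_sum]
  refine Finset.sum_congr rfl fun k _ => ?_
  simp only [g]
  have h4 : ((L : ℤ) - u) = ((L - u : ℕ) : ℤ) := (Nat.cast_sub huL).symm
  rw [qBinom_natCast, qBinom_natCast, h4, qBinom_natCast,
    show (L : ℤ) - (u + (k + a)) = (L - u : ℕ) - (k + a) by rw [← h4]; ring,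
    show (u : ℤ) + (k + a) - 2 * k - a = u - k by ring,
    show ((u : ℤ) + (k + a)) * (u + (k + a) - n) + (u - k) * (u - k - n) =
      a * (a - n) + 2 * (u * (u + a - n)) + 2 * (k * (k + a)) by ring,
    zpow_add₀ hr0, zpow_add₀ hr0, zpow_mul r 2, zpow_mul r 2, show r ^ (2 : ℤ) = q from mod_cast hr]
  have h5 : qPoch q q u * recipQPoch q u * (qPoch q q (L - u) * recipQPoch q (L - u : ℕ)) = 1 := by
    rw [qPoch_mul_recipQPoch hq, qPoch_mul_recipQPoch hq, one_mul]
  linear_combination -(r ^ (a * (a - n)) * q ^ ((u : ℤ) * (u + a - n)) *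
    q ^ ((k : ℤ) * (k + a)) * (qPoch q q L * recipQPoch q ((L - u : ℕ) - (k + a)) *
      recipQPoch q k * recipQPoch q (k + a) * recipQPoch q (u - k))) * h5

/-! ### Summation for `n = 1` and `n = -1` -/

theorem one_add_pow_mul_sum_qBinom (hq0 : q ≠ 0) (hq : ∀ n : ℕ, 1 ≤ n → q ^ n ≠ 1) (L : ℕ)
    (a : ℤ) :
    (1 + q ^ L) * ∑ u ∈ Finset.range (L + 1),
        q ^ ((u : ℤ) * (u + a - 1)) * qBinom q L u * qBinom q L (u + a) =
      (1 + q ^ a) * qBinom q (2 * L) (L - a) := by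
  obtain _ | M := L
  · rcases eq_or_ne a 0 with rfl | ha
    · simp [qBinom, qPoch]
    · simp [qBinom_eq_zero q 0 a (by omega), qBinom_eq_zero q 0 (-a) (by omega)]
  -- Inserts `1 = q^u + (1 - q^u)` and absorbs `1 - q^u` into the binomial; both resulting sums are
  -- `q`-Vandermonde.
  have h1 : ∀ u : ℕ, q ^ ((u : ℤ) * (u + a - 1)) * qBinom q ((M + 1 : ℕ) : ℤ) u *
      qBinom q ((M + 1 : ℕ) : ℤ) (u + a) =
      q ^ ((u : ℤ) * (u + a)) * qBinom q ((M + 1 : ℕ) : ℤ) u *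
        qBinom q ((M + 1 : ℕ) : ℤ) (u + a) +
      (1 - q ^ (M + 1)) * (q ^ ((u : ℤ) * (u + a - 1)) * qBinom q M (u - 1) *
        qBinom q ((M + 1 : ℕ) : ℤ) (u + a)) := by
    intro u
    have h := one_sub_zpow_mul_qBinom hq M u
    rw [show (u : ℤ) * (u + a) = u * (u + a - 1) + u by ring, zpow_add₀ hq0]
    linear_combination q ^ ((u : ℤ) * (u + a - 1)) * qBinom q ((M + 1 : ℕ) : ℤ) (u + a) * h
  have h2 : ∀ w : ℕ, q ^ (((w + 1 : ℕ) : ℤ) * ((w + 1 : ℕ) + a - 1)) *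
      qBinom q M ((w + 1 : ℕ) - 1) * qBinom q ((M + 1 : ℕ) : ℤ) ((w + 1 : ℕ) + a) =
      q ^ a * (q ^ ((w : ℤ) * (w + (a + 1))) * qBinom q M w *
        qBinom q ((M + 1 : ℕ) : ℤ) (w + (a + 1))) := by
    intro w
    rw [← mul_assoc, ← mul_assoc, ← zpow_add₀ hq0]
    push_cast
    ring_nf
  simp_rw [h1]
  rw [Finset.sum_add_distrib, ← Finset.mul_sum, sum_qBinom_mul_qBinom hq0 hq,
    Finset.sum_range_succ']
  simp_rw [h2]
  rw [← Finset.mul_sum, sum_qBinom_mul_qBinom hq0 hq,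
    qBinom_eq_zero q M (((0 : ℕ) : ℤ) - 1) (by left; simp)]
  -- With `L = M + 1`, the factor `(1 + q^L)(1 - q^L) = 1 - q^{2L}` turns `[2L-1, L-a-1]` into `(1 -
  -- q^{L-a}) [2L, L-a]`.
  have h3 := one_sub_zpow_mul_qBinom hq (M + (M + 1)) ((M + 1 : ℕ) - a)
  have h4 : q ^ a * q ^ (((M + 1 : ℕ) : ℤ) - a) = q ^ (M + 1) := by
    rw [← zpow_add₀ hq0, add_sub_cancel, zpow_natCast]
  have h5 : q ^ (M + (M + 1) + 1) = q ^ (M + 1) * q ^ (M + 1) := by ring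
  rw [sub_sub] at h3
  rw [h5] at h3
  rw [show (M + 1 + (M + 1)) = M + (M + 1) + 1 by ring,
    show (2 * ((M + 1 : ℕ) : ℤ)) = ((M + (M + 1) + 1 : ℕ) : ℤ) by push_cast; ring]
  linear_combination -q ^ a * h3 -
    qBinom q ((M + (M + 1) + 1 : ℕ) : ℤ) ((M + 1 : ℕ) - a) * h4

/-- Termwise, Pascal merges `[L, u+a]` and `[L, u+a+1]` into `[L+1, u+a+1]`; `q`-Vandermonde then
applies. -/
theorem sum_qBinom_mul_qBinom_succ (hq0 : q ≠ 0) (hq : ∀ n : ℕ, 1 ≤ n → q ^ n ≠ 1) (L : ℕ)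
    (a : ℤ) :
    ∑ u ∈ Finset.range (L + 1),
        q ^ ((u : ℤ) * (u + a - -1)) * qBinom q L u * qBinom q L (u + a) +
      q ^ (a + 1) * ∑ u ∈ Finset.range (L + 1),
        q ^ ((u : ℤ) * (u + (a + 1) - -1)) * qBinom q L u * qBinom q L (u + (a + 1)) =
      qBinom q (2 * L + 1) (L - a) := by
  rw [show (2 * (L : ℤ) + 1) = ((L + (L + 1) : ℕ) : ℤ) by push_cast; ring,
    show (L : ℤ) - a = (L + 1 : ℕ) - (a + 1) by push_cast; ring,
    ← sum_qBinom_mul_qBinom hq0 hq, Finset.mul_sum, ← Finset.sum_add_distrib]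
  refine Finset.sum_congr rfl fun u _ => ?_
  have h : q ^ ((u : ℤ) * (u + (a + 1) - -1)) = q ^ ((u : ℤ) * (u + (a + 1))) * q ^ (u : ℤ) := by
    rw [← zpow_add₀ hq0]
    congr 1
    ring
  rw [qBinom_succ' hq0 hq, show (u : ℤ) + (a + 1) - 1 = u + a by ring, h,
    show (u : ℤ) * (u + a - -1) = u * (u + (a + 1)) by ring, zpow_add₀ hq0 (u : ℤ) (a + 1)]
  ring

/-! ### Finite summation windows and half-integral powers -/

/-- Interchange of summation: a `q`-binomial transform of a sequence expanded in kernels `t i a`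
supported on `-i - 1 ≤ a ≤ i` may be computed kernel by kernel. -/
theorem finsum_qBinom_mul_finsum (q : K) (w : ℕ → K) (F : ℕ → K) (α : ℤ → K) (t : ℕ → ℤ → K)
    (ht : ∀ (i : ℕ) (a : ℤ), a < -i - 1 ∨ (i : ℤ) < a → t i a = 0) (hF : ∀ i, F i = ∑ᶠ a, α a * t i a)
    (L : ℕ) :
    ∑ᶠ i : ℕ, w i * qBinom q L i * F i =
      ∑ a ∈ Finset.Icc (-L - 1 : ℤ) L,
        α a * ∑ i ∈ Finset.range (L + 1), w i * qBinom q L i * t i a := by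
  rw [finsum_eq_sum_of_support_subset (s := Finset.range (L + 1))]
  · simp_rw [Finset.mul_sum]
    rw [Finset.sum_comm]
    refine Finset.sum_congr rfl fun i hi => ?_
    have hiL : i < L + 1 := by simpa using hi
    rw [hF, finsum_eq_sum_of_support_subset (s := Finset.Icc (-L - 1 : ℤ) L), Finset.mul_sum]
    · exact Finset.sum_congr rfl fun a _ => by ring
    · intro a ha
      by_contra h
      refine ha ?_
      rw [Finset.coe_Icc, Set.mem_Icc] at h
      simp [ht i a (by omega)]
  · intro i hi
    by_contra h
    refine hi ?_
    have h' : L < i := by simpa [Nat.lt_succ_iff] using h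
    simp [qBinom_eq_zero q L i (by omega)]

/-- The end `a = -L - 1` is needed for `N = 2L + 1`, where the binomial is `[2L+1, 2L+1] = 1`. -/
theorem finsum_mul_qBinom_sub (q : K) (L : ℕ) (N : ℤ) (hN : N ≤ 2 * L + 1) (f : ℤ → K) :
    ∑ᶠ a : ℤ, f a * qBinom q N (L - a) =
      ∑ a ∈ Finset.Icc (-L - 1 : ℤ) L, f a * qBinom q N (L - a) := by
  refine finsum_eq_sum_of_support_subset _ fun a ha => ?_
  by_contra h
  refine ha ?_
  rw [Finset.coe_Icc, Set.mem_Icc] at h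
  simp [qBinom_eq_zero q N (L - a) (by omega)]

theorem zpow_mul_sub_one_div_two (hr : r ^ 2 = q) (a : ℤ) :
    q ^ (a * (a - 1) / 2) = r ^ (a * (a - 1)) := by
  rw [← hr, ← zpow_natCast, ← zpow_mul]
  congr 1
  exact Int.mul_ediv_cancel' (Int.even_mul_pred_self a).two_dvd

theorem pow_choose_two (hr : r ^ 2 = q) (i : ℕ) :
    q ^ i.choose 2 = r ^ ((i : ℤ) * (i - 1)) := by
  rw [← zpow_mul_sub_one_div_two hr, ← zpow_natCast]
  congr 1
  rw [Nat.choose_two_right]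
  rcases i with _ | i
  · simp
  · push_cast
    simp

end Basic

end QTrinomial

/-! ### The three transformations -/

theorem mainTheorem10 {K : Type*} [Field K] (q r : K) (hr : r ^ 2 = q) (hq0 : q ≠ 0)
    (hq : ∀ n : ℕ, 1 ≤ n → q ^ n ≠ 1)
    (F₀ F₁ Fₘ : ℕ → K) (α₀ α₁ αₘ : ℤ → K) :
    ((∀ L : ℕ, F₀ L = ∑ᶠ a : ℤ, α₀ a * QTrinomial.T r 0 L a) →
      ∀ L : ℕ, ∑ᶠ i : ℕ, r ^ (i ^ 2) * QTrinomial.qBinom q L i * F₀ i =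
        ∑ᶠ a : ℤ, α₀ a * r ^ (a ^ 2) * QTrinomial.qBinom q (2 * L) (L - a)) ∧
    ((∀ L : ℕ, F₁ L = ∑ᶠ a : ℤ, α₁ a * QTrinomial.T r 1 L a) →
      ∀ L : ℕ, (1 + q ^ L) * ∑ᶠ i : ℕ, q ^ (i.choose 2) * QTrinomial.qBinom q L i * F₁ i =
        ∑ᶠ a : ℤ, α₁ a * (1 + q ^ a) * q ^ (a * (a - 1) / 2) *
          QTrinomial.qBinom q (2 * L) (L - a)) ∧
    ((∀ L : ℕ, Fₘ L =
        ∑ᶠ a : ℤ, αₘ a * (QTrinomial.T r (-1) L a + QTrinomial.T r (-1) L (a + 1))) →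
      ∀ L : ℕ, ∑ᶠ i : ℕ, q ^ ((i + 1).choose 2) * QTrinomial.qBinom q L i * Fₘ i =
        ∑ᶠ a : ℤ, αₘ a * q ^ ((a + 1) * a / 2) *
          QTrinomial.qBinom q (2 * L + 1) (L - a)) := by
  have hr0 : r ≠ 0 := by rintro rfl; simp at hr; exact hq0 hr.symm
  refine ⟨fun h L => ?_, fun h L => ?_, fun h L => ?_⟩
  · rw [QTrinomial.finsum_qBinom_mul_finsum q _ F₀ α₀ (QTrinomial.T r 0)
      (fun i a ha => QTrinomial.T_eq_zero r 0 i a (by omega)) h,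
      QTrinomial.finsum_mul_qBinom_sub q L _ (by omega)]
    refine Finset.sum_congr rfl fun a _ => ?_
    have key := QTrinomial.sum_qBinom_mul_T hr hq0 hq 0 L a
    simp only [sub_zero, ← sq] at key
    rw [QTrinomial.sum_qBinom_mul_qBinom hq0 hq, ← two_mul] at key
    push_cast at key
    rw [mul_assoc, ← key]
    norm_cast
  · rw [QTrinomial.finsum_qBinom_mul_finsum q _ F₁ α₁ (QTrinomial.T r 1)
      (fun i a ha => QTrinomial.T_eq_zero r 1 i a (by omega)) h,
      QTrinomial.finsum_mul_qBinom_sub q L _ (by omega), Finset.mul_sum]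
    refine Finset.sum_congr rfl fun a _ => ?_
    simp_rw [QTrinomial.pow_choose_two hr]
    rw [QTrinomial.sum_qBinom_mul_T hr hq0 hq, QTrinomial.zpow_mul_sub_one_div_two hr]
    linear_combination α₁ a * r ^ (a * (a - 1)) *
      QTrinomial.one_add_pow_mul_sum_qBinom hq0 hq L a
  · rw [QTrinomial.finsum_qBinom_mul_finsum q _ Fₘ αₘ
      (fun i a => QTrinomial.T r (-1) i a + QTrinomial.T r (-1) i (a + 1))
      (fun i a ha => by
        rw [QTrinomial.T_eq_zero r (-1) i a (by omega),
          QTrinomial.T_eq_zero r (-1) i (a + 1) (by omega), add_zero]) h,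
      QTrinomial.finsum_mul_qBinom_sub q L _ (by omega)]
    refine Finset.sum_congr rfl fun a _ => ?_
    have hw : ∀ i : ℕ, q ^ (i + 1).choose 2 = r ^ ((i : ℤ) * (i - -1)) := by
      intro i
      rw [QTrinomial.pow_choose_two hr]
      congr 1
      push_cast
      ring
    have ha : q ^ ((a + 1) * a / 2) = r ^ (a * (a - -1)) := by
      have := QTrinomial.zpow_mul_sub_one_div_two hr (a + 1)
      rw [add_sub_cancel_right] at this
      rw [this, sub_neg_eq_add, mul_comm]
    -- The prefactor for `a + 1` exceeds that for `a` by `q^{a+1}`, exactly the weight of the second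
    -- sum in `sum_qBinom_mul_qBinom_succ`.
    have ha' : r ^ ((a + 1) * (a + 1 - -1)) = r ^ (a * (a - -1)) * q ^ (a + 1) := by
      rw [← hr, ← zpow_natCast, ← zpow_mul, ← zpow_add₀ hr0]
      congr 1
      push_cast
      ring
    simp_rw [hw, mul_add]
    rw [Finset.sum_add_distrib, QTrinomial.sum_qBinom_mul_T hr hq0 hq,
      QTrinomial.sum_qBinom_mul_T hr hq0 hq, ha, ha']
    linear_combination αₘ a * r ^ (a * (a - -1)) *
      QTrinomial.sum_qBinom_mul_qBinom_succ hq0 hq L a
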